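/- Let $\Gamma$ be a finite simple graph and let $A_\Gamma = \langle V(\Gamma) \mid ss' = s's \text{ for all } \{s,s'\} \in E(\Gamma)\rangle$ be the associated right-angled Artin group. For $g \in A_\Gamma$ let $|g|$ be the length of a shortest word over $X = V(\Gamma)^{\pm 1}$ representing $g$. Let $\phi \in \mathrm{Aut}(A_\Gamma)$ be length-preserving, that is, $|\phi(g)| = |g|$ for all $g \in A_\Gamma$, and let $m \geq 1$ be an integer with $\phi^m = 1$ (for instance, the order of $\phi$). Then the conjugacy problem is solvable in the virtual right-angled Artin group $$A_\phi = A_\Gamma \rtimes_\phi \mathbb{Z}/m\mathbb{Z} = \langle V(\Gamma), t \mid ss' = s's\ (\{s,s'\} \in E(\Gamma)),\ t^m = 1,\ t^{-1}xt = \phi(x)\ (x \in V(\Gamma))\rangle .$$ That is, for every finite generating set $Y$ of $A_\phi$ there is an algorithm that decides, given two words over $Y \cup Y^{-1}$, whether they represent conjugate elements of $A_\phi$. -/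

import Mathlib

/-- The element of `G` represented by a word in the letters `x i` and `(x i)⁻¹`;
`(i, true)` stands for `x i` and `(i, false)` for its inverse. -/
def wordValue {ι G : Type*} [Group G] (x : ι → G) (w : List (ι × Bool)) : G :=
  (w.map fun a => if a.2 then x a.1 else (x a.1)⁻¹).prod

/-- The word length of `g`: the least length of a word in the letters `x i` and `(x i)⁻¹`
that represents `g` (meaningful when the family `x` generates `G`). -/
noncomputable def wordLength {ι G : Type*} [Group G] (x : ι → G) (g : G) : ℕ :=
  sInf {l : ℕ | ∃ w : List (ι × Bool), wordValue x w = g ∧ w.length = l}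

/-- An automorphism of `G = ⟨x⟩` is length-preserving if it preserves the length of every element
represented by a word over the letters `x i` and `(x i)⁻¹`. -/
def IsLengthPreserving {ι G : Type*} [Group G] (x : ι → G) (φ : MulAut G) : Prop :=
  ∀ w : List (ι × Bool), wordLength x (wordValue x w) = wordLength x (φ (wordValue x w))

/-- The conjugacy problem of `G` is solvable: for every finite generating family `x` of `G`, there
is an algorithm that decides, given two words in the letters `x i` and `(x i)⁻¹`, whether they
represent conjugate elements of `G`. -/
def ConjugacyProblemSolvable (G : Type*) [Group G] : Prop :=
  ∀ (k : ℕ) (x : Fin k → G), Subgroup.closure (Set.range x) = ⊤ →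
    ComputablePred fun p : List (Fin k × Bool) × List (Fin k × Bool) =>
      IsConj (wordValue x p.1) (wordValue x p.2)

/-- The right-angled Artin group of a simple graph: generated by the vertices, with the relations
`[s, t] = 1` for adjacent vertices `s` and `t`. -/
abbrev RAAG {V : Type*} (Γ : SimpleGraph V) : Type _ :=
  PresentedGroup {r : FreeGroup V | ∃ s t : V, Γ.Adj s t ∧
    r = FreeGroup.of s * FreeGroup.of t * (FreeGroup.of s)⁻¹ * (FreeGroup.of t)⁻¹}

/-- The standard generators of the right-angled Artin group. -/
def RAAG.gen {V : Type*} (Γ : SimpleGraph V) (v : V) : RAAG Γ := PresentedGroup.of v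

/-- The action of `ℤ/mℤ` on a group `N` in which the generator `1` acts as `ψ`, where `ψ ^ m = 1`. -/
def cyclicAction {N : Type*} [Group N] (m : ℕ) (ψ : MulAut N) (h : ψ ^ m = 1) :
    Multiplicative (ZMod m) →* MulAut N :=
  AddMonoidHom.toMultiplicativeLeft
    (ZMod.lift m ⟨AddMonoidHom.toMultiplicativeLeft.symm (zpowersHom (MulAut N) ψ), by
      simpa using congrArg Additive.ofMul h⟩)

/-- The extension `N ⋊_φ ℤ/mℤ` in which the generator `t` of `ℤ/mℤ` satisfies `t⁻¹ x t = φ x` for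
all `x` in `N`. Mathlib's semidirect product has `t x t⁻¹ = α(t) x`, so `t` acts as `φ⁻¹`. -/
abbrev CyclicExtension {N : Type*} [Group N] (m : ℕ) (φ : MulAut N) (h : φ ^ m = 1) : Type _ :=
  N ⋊[cyclicAction m φ⁻¹ (by rw [inv_pow, h, inv_one])] Multiplicative (ZMod m)

theorem cyclicAction_gen {N : Type*} [Group N] (m : ℕ) (ψ : MulAut N) (h : ψ ^ m = 1) :
    cyclicAction m ψ h (Multiplicative.ofAdd 1) = ψ := by
  have := ZMod.lift_coe m (⟨AddMonoidHom.toMultiplicativeLeft.symm (zpowersHom (MulAut N) ψ), by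
      simpa using congrArg Additive.ofMul h⟩ : {f : ℤ →+ Additive (MulAut N) // f m = 0}) 1
  simp only [Int.cast_one] at this
  simp [cyclicAction, this]

theorem CyclicExtension.conj_gen {N : Type*} [Group N] (m : ℕ) (φ : MulAut N) (h : φ ^ m = 1)
    (x : N) :
    ((SemidirectProduct.inr (Multiplicative.ofAdd 1))⁻¹ * SemidirectProduct.inl x *
      SemidirectProduct.inr (Multiplicative.ofAdd 1) : CyclicExtension m φ h) =
      SemidirectProduct.inl (φ x) := by
  have hx := SemidirectProduct.inl_aut (φ := cyclicAction m φ⁻¹ (by rw [inv_pow, h, inv_one]))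
    (Multiplicative.ofAdd 1) (φ x)
  rw [cyclicAction_gen, MulAut.inv_apply_self, map_inv] at hx
  rw [hx]
  group

/-! Let C be the number of letters. An equation Z X Z⁻¹ = Y in the extension reads u h = g ψ(u) on
left components, where u and g are those of Z and Y, h is a translate of that of X, and ψ preserves
length. The task is to replace u by a solution of computably bounded length.

Cut u into the prefixes u_i of its Foata normal form, whose factors are products of pairwise
commuting letters. Uniformly in i, right multiplication by a letter changes the i-th prefix by at
most one letter (`len_foataPrefix_mul_letter`), and left multiplication by a letter commutes with
taking it up to an error of length C (`len_foataPrefix_letter_mul`). A length-preserving ψ permutes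
the letters, so it commutes with prefixes (`map_foataPrefix`). Hence every u_i⁻¹ g ψ(u_i) has length
at most C|g| + |h|. These elements form a walk from g to h in a finite graph whose edges are twisted
conjugations by elements of length at most C; a path with the same ends gives the short solution
(`exists_short_twisted_conjugator`).

Conjugacy is then decided by bounded search and the word problem. The latter is solved by letting
the group act on tuples of projections to nonadjacent pairs of vertices: an element is trivial
exactly when its tuple is empty. The same tuples define left descents and length. -/

namespace RAAG

variable {V : Type*} (Γ : SimpleGraph V)

/-- The inverse letter. -/
def letterInv (a : V × Bool) : V × Bool := (a.1, !a.2)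

@[simp] theorem letterInv_fst (a : V × Bool) : (letterInv a).1 = a.1 := rfl

@[simp] theorem letterInv_letterInv (a : V × Bool) : letterInv (letterInv a) = a := by
  simp [letterInv]

/-- The element of the right-angled Artin group represented by a letter. -/
def letter (a : V × Bool) : RAAG Γ := if a.2 then gen Γ a.1 else (gen Γ a.1)⁻¹

@[simp] theorem letter_letterInv (a : V × Bool) : letter Γ (letterInv a) = (letter Γ a)⁻¹ := by
  rcases a with ⟨v, _ | _⟩ <;> simp [letter, letterInv]

/-- The element of the right-angled Artin group represented by a word. -/
def word (w : List (V × Bool)) : RAAG Γ := (w.map (letter Γ)).prod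

@[simp] theorem word_nil : word Γ [] = 1 := rfl

@[simp] theorem word_cons (a : V × Bool) (w : List (V × Bool)) :
    word Γ (a :: w) = letter Γ a * word Γ w := by simp [word]

@[simp] theorem word_append (w w' : List (V × Bool)) :
    word Γ (w ++ w') = word Γ w * word Γ w' := by simp [word]

theorem wordValue_gen (w : List (V × Bool)) : wordValue (gen Γ) w = word Γ w := rfl

theorem gen_commute {v w : V} (h : Γ.Adj v w) : Commute (gen Γ v) (gen Γ w) := by
  have h1 : (PresentedGroup.mk {r : FreeGroup V | ∃ s t : V, Γ.Adj s t ∧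
      r = FreeGroup.of s * FreeGroup.of t * (FreeGroup.of s)⁻¹ * (FreeGroup.of t)⁻¹})
      (FreeGroup.of v * FreeGroup.of w * (FreeGroup.of v)⁻¹ * (FreeGroup.of w)⁻¹) = 1 :=
    PresentedGroup.one_of_mem ⟨v, w, h, rfl⟩
  rw [map_mul, map_mul, map_mul, map_inv, map_inv] at h1
  have h2 := mul_inv_eq_one.mp h1
  exact mul_inv_eq_iff_eq_mul.mp h2

theorem letter_commute {a b : V × Bool} (h : Γ.Adj a.1 b.1) :
    Commute (letter Γ a) (letter Γ b) := by
  have := gen_commute Γ h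
  rcases a with ⟨v, _ | _⟩ <;> rcases b with ⟨w, _ | _⟩ <;>
    simp only [letter, if_true, Bool.false_eq_true, if_false]
  · exact this.inv_inv
  · exact this.inv_left
  · exact this.inv_right
  · exact this

/-! ### Projections to nonadjacent pairs, and the action on them -/

/-- The letters at `v` are recorded in the coordinate `c`: the pair `c` is nonadjacent and
contains `v`. -/
def Acts (v : V) (c : V × V) : Prop := ¬ Γ.Adj c.1 c.2 ∧ (c.1 = v ∨ c.2 = v)

theorem acts_self (v : V) : Acts Γ v (v, v) := ⟨Γ.loopless.irrefl v, Or.inl rfl⟩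

theorem acts_diag {v w : V} : Acts Γ v (w, w) ↔ w = v := by simp [Acts]

-- A coordinate recording both vertices would be an adjacent pair or force a loop. Thus commuting
-- letters touch disjoint sets of coordinates.
variable {Γ} in
theorem Acts.not_acts {v w : V} {c : V × V} (h : Γ.Adj v w) (hv : Acts Γ v c) : ¬ Acts Γ w c := by
  rintro ⟨h1, h2⟩
  obtain ⟨_, h4⟩ := hv
  rcases h4 with rfl | rfl <;> rcases h2 with rfl | rfl
  · exact Γ.loopless.irrefl _ h
  · exact h1 h
  · exact h1 h.symm
  · exact Γ.loopless.irrefl _ h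

/-- The projections of a trace to the pairs of vertices. -/
abbrev State (V : Type*) := V × V → List (V × Bool)

/-- The letter `a` heads all coordinates in which it is recorded. -/
def Heads (a : V × Bool) (σ : State V) : Prop := ∀ c, Acts Γ a.1 c → (σ c).head? = some a

open Classical in
/-- Put the letter `a` in front. -/
noncomputable def consLetter (a : V × Bool) (σ : State V) : State V :=
  fun c => if Acts Γ a.1 c then a :: σ c else σ c

open Classical in
/-- Remove the front letter at the vertex `v`. -/
noncomputable def tailLetter (v : V) (σ : State V) : State V :=
  fun c => if Acts Γ v c then (σ c).tail else σ c

open Classical in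
/-- Left multiplication by a letter. -/
noncomputable def push (a : V × Bool) (σ : State V) : State V :=
  if Heads Γ (letterInv a) σ then tailLetter Γ a.1 σ else consLetter Γ a σ

theorem push_of_heads {a : V × Bool} {σ : State V} (h : Heads Γ (letterInv a) σ) :
    push Γ a σ = tailLetter Γ a.1 σ := if_pos h

theorem push_of_not_heads {a : V × Bool} {σ : State V} (h : ¬ Heads Γ (letterInv a) σ) :
    push Γ a σ = consLetter Γ a σ := if_neg h

theorem heads_consLetter (a : V × Bool) (σ : State V) : Heads Γ a (consLetter Γ a σ) := by
  intro c hc; simp [consLetter, hc]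

@[simp] theorem tailLetter_consLetter (a : V × Bool) (σ : State V) :
    tailLetter Γ a.1 (consLetter Γ a σ) = σ := by
  funext c
  by_cases h : Acts Γ a.1 c <;> simp [tailLetter, consLetter, h]

variable {Γ} in
theorem Heads.consLetter_tailLetter {a : V × Bool} {σ : State V} (h : Heads Γ a σ) :
    consLetter Γ a (tailLetter Γ a.1 σ) = σ := by
  funext c
  by_cases hc : Acts Γ a.1 c
  · simp only [tailLetter, consLetter, hc, if_true]
    exact List.cons_head?_tail (h c hc)
  · simp [tailLetter, consLetter, hc]

-- If the vertices are equal or nonadjacent, the coordinate `(a.1, b.1)` records both letters, and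
-- it has only one head.
variable {Γ} in
theorem Heads.eq_or_adj {a b : V × Bool} {σ : State V} (ha : Heads Γ a σ) (hb : Heads Γ b σ) :
    a = b ∨ Γ.Adj a.1 b.1 := by
  by_contra! h
  have h1 := ha (a.1, b.1) ⟨h.2, Or.inl rfl⟩
  have h2 := hb (a.1, b.1) ⟨h.2, Or.inr rfl⟩
  exact h.1 (Option.some.inj (h1.symm.trans h2))

variable {Γ}

theorem heads_consLetter_of_adj {a b : V × Bool} (h : Γ.Adj a.1 b.1) (σ : State V) :
    Heads Γ a (consLetter Γ b σ) ↔ Heads Γ a σ := by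
  refine forall₂_congr fun c hc => ?_
  simp [consLetter, hc.not_acts h]

theorem heads_tailLetter_of_adj {a : V × Bool} {v : V} (h : Γ.Adj a.1 v) (σ : State V) :
    Heads Γ a (tailLetter Γ v σ) ↔ Heads Γ a σ := by
  refine forall₂_congr fun c hc => ?_
  simp [tailLetter, hc.not_acts h]

theorem heads_push_of_adj {a b : V × Bool} (h : Γ.Adj a.1 b.1) (σ : State V) :
    Heads Γ a (push Γ b σ) ↔ Heads Γ a σ := by
  unfold push
  split_ifs
  · exact heads_tailLetter_of_adj h σ
  · exact heads_consLetter_of_adj h σ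

theorem tailLetter_consLetter_of_adj {a : V × Bool} {v : V} (h : Γ.Adj v a.1) (σ : State V) :
    tailLetter Γ v (consLetter Γ a σ) = consLetter Γ a (tailLetter Γ v σ) := by
  funext c
  by_cases h1 : Acts Γ v c
  · simp [tailLetter, consLetter, h1, h1.not_acts h]
  · simp [tailLetter, consLetter, h1]

theorem push_comm {a b : V × Bool} (h : Γ.Adj a.1 b.1) (σ : State V) :
    push Γ a (push Γ b σ) = push Γ b (push Γ a σ) := by
  have ha : Γ.Adj (letterInv a).1 b.1 := h
  have hb : Γ.Adj (letterInv b).1 a.1 := h.symm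
  rw [push.eq_1 Γ a (push Γ b σ), push.eq_1 Γ b (push Γ a σ), heads_push_of_adj ha,
    heads_push_of_adj hb]
  unfold push
  funext c
  by_cases h1 : Acts Γ a.1 c
  · have := h1.not_acts h
    split_ifs <;> simp [tailLetter, consLetter, h1, this]
  · split_ifs <;> simp [tailLetter, consLetter, h1]

variable (Γ) in
/-- The states of reduced words. -/
inductive IsReduced : State V → Prop
  | nil : IsReduced fun _ => []
  | cons (a : V × Bool) (σ : State V) : IsReduced σ → ¬ Heads Γ (letterInv a) σ →
      IsReduced (consLetter Γ a σ)

theorem not_heads_nil (a : V × Bool) : ¬ Heads Γ a fun _ => [] := by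
  intro h; simpa using h _ (acts_self Γ a.1)

theorem IsReduced.tailLetter {σ : State V} (h : IsReduced Γ σ) {a : V × Bool}
    (ha : Heads Γ a σ) :
    IsReduced Γ (tailLetter Γ a.1 σ) ∧ ¬ Heads Γ (letterInv a) (RAAG.tailLetter Γ a.1 σ) := by
  induction h with
  | nil => exact (not_heads_nil a ha).elim
  | cons b τ hτ hb ih =>
    rcases ha.eq_or_adj (heads_consLetter Γ b τ) with rfl | hab
    · rw [tailLetter_consLetter]; exact ⟨hτ, hb⟩
    · obtain ⟨h1, h2⟩ := ih ((heads_consLetter_of_adj hab τ).mp ha)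
      rw [tailLetter_consLetter_of_adj hab]
      refine ⟨.cons b _ h1 ?_, ?_⟩
      · rwa [heads_tailLetter_of_adj (a := letterInv b) hab.symm]
      · rwa [heads_consLetter_of_adj (a := letterInv a) hab]

theorem IsReduced.push {σ : State V} (h : IsReduced Γ σ) (a : V × Bool) :
    IsReduced Γ (push Γ a σ) := by
  unfold RAAG.push
  split_ifs with ha
  · exact (h.tailLetter ha).1
  · exact .cons a σ h ha

/-- Reducedness is essential: if `a` headed the state with its inverse directly behind, both pushes
would cancel. This is why the group acts on reduced states only. -/
theorem IsReduced.push_push_letterInv {σ : State V} (h : IsReduced Γ σ) (a : V × Bool) :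
    RAAG.push Γ a (RAAG.push Γ (letterInv a) σ) = σ := by
  by_cases ha : Heads Γ a σ
  · rw [push_of_heads Γ (a := letterInv a) (by simpa using ha), letterInv_fst,
      push_of_not_heads Γ (h.tailLetter ha).2, ha.consLetter_tailLetter]
  · rw [push_of_not_heads Γ (a := letterInv a) (by simpa using ha),
      push_of_heads Γ (heads_consLetter Γ _ σ)]
    exact tailLetter_consLetter Γ (letterInv a) σ

variable (Γ)

/-- Left multiplication by a letter as a permutation of the reduced states. -/
noncomputable def pushPerm (a : V × Bool) : Equiv.Perm {σ : State V // IsReduced Γ σ} where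
  toFun σ := ⟨push Γ a σ.1, σ.2.push a⟩
  invFun σ := ⟨push Γ (letterInv a) σ.1, σ.2.push _⟩
  left_inv σ := Subtype.ext (by simpa using σ.2.push_push_letterInv (letterInv a))
  right_inv σ := Subtype.ext (σ.2.push_push_letterInv a)

/-- The action of the right-angled Artin group on reduced states. -/
noncomputable def stateAction : RAAG Γ →* Equiv.Perm {σ : State V // IsReduced Γ σ} :=
  PresentedGroup.toGroup (f := fun v => pushPerm Γ (v, true)) (by
    rintro r ⟨s, t, h, rfl⟩
    simp only [map_mul, map_inv, FreeGroup.lift_apply_of]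
    rw [mul_inv_eq_one, mul_inv_eq_iff_eq_mul]
    ext1 σ
    exact Subtype.ext (push_comm (a := (s, true)) (b := (t, true)) h σ.1))

theorem stateAction_letter (a : V × Bool) : stateAction Γ (letter Γ a) = pushPerm Γ a := by
  have h : ∀ v, stateAction Γ (gen Γ v) = pushPerm Γ (v, true) := fun v =>
    PresentedGroup.toGroup.of _
  rcases a with ⟨v, _ | _⟩
  · simp only [letter, Bool.false_eq_true, if_false, map_inv, h]
    rfl
  · simp only [letter, if_true, h]

/-- The state of an element of the right-angled Artin group. -/
noncomputable def state (g : RAAG Γ) : State V := (stateAction Γ g ⟨_, .nil⟩).1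

theorem isReduced_state (g : RAAG Γ) : IsReduced Γ (state Γ g) := (stateAction Γ g ⟨_, .nil⟩).2

@[simp] theorem state_one : state Γ 1 = fun _ => [] := by simp [state]

theorem state_letter_mul (a : V × Bool) (g : RAAG Γ) :
    state Γ (letter Γ a * g) = push Γ a (state Γ g) := by
  simp [state, stateAction_letter, pushPerm]

theorem state_word (w : List (V × Bool)) :
    state Γ (word Γ w) = w.foldr (push Γ) fun _ => [] := by
  induction w with
  | nil => simp
  | cons a w ih => rw [word_cons, state_letter_mul, ih, List.foldr_cons]

theorem exists_word (g : RAAG Γ) : ∃ w, word Γ w = g := by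
  induction g using PresentedGroup.induction_on with | _ z
  induction z using FreeGroup.induction_on with
  | C1 => exact ⟨[], by simp⟩
  | of v => exact ⟨[(v, true)], by simp [letter]; rfl⟩
  | inv_of v _ => exact ⟨[(v, false)], by simp [letter]; rfl⟩
  | mul x y hx hy =>
    obtain ⟨u, hu⟩ := hx
    obtain ⟨w, hw⟩ := hy
    exact ⟨u ++ w, by rw [word_append, hu, hw, map_mul]⟩

/-! ### Left descents, reduced words and length -/

/-- The letter `a` is a left descent of `g`: some shortest word for `g` begins with `a`. -/
def IsDescent (a : V × Bool) (g : RAAG Γ) : Prop := Heads Γ a (state Γ g)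

variable {Γ}

theorem IsDescent.eq_or_adj {a b : V × Bool} {g : RAAG Γ} (ha : IsDescent Γ a g)
    (hb : IsDescent Γ b g) : a = b ∨ Γ.Adj a.1 b.1 := Heads.eq_or_adj ha hb

theorem isDescent_letter_mul_of_adj {a b : V × Bool} (h : Γ.Adj a.1 b.1) (g : RAAG Γ) :
    IsDescent Γ a (letter Γ b * g) ↔ IsDescent Γ a g := by
  rw [IsDescent, state_letter_mul, heads_push_of_adj h, IsDescent]

theorem isDescent_letter_mul_self (a : V × Bool) (g : RAAG Γ) :
    IsDescent Γ a (letter Γ a * g) ↔ ¬ IsDescent Γ (letterInv a) g := by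
  rw [IsDescent, state_letter_mul, IsDescent]
  by_cases h : Heads Γ (letterInv a) (state Γ g)
  · rw [push_of_heads Γ h]
    simpa [h] using ((isReduced_state Γ g).tailLetter h).2
  · simp only [push_of_not_heads Γ h, heads_consLetter, h, not_false_eq_true]

theorem not_isDescent_one (a : V × Bool) : ¬ IsDescent Γ a 1 := by
  rw [IsDescent, state_one]; exact not_heads_nil a

variable (Γ) in
/-- A word each of whose letters lengthens the word after it. -/
inductive ReducedWord : List (V × Bool) → Prop
  | nil : ReducedWord []
  | cons (a : V × Bool) (w : List (V × Bool)) : ReducedWord w →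
      ¬ IsDescent Γ (letterInv a) (word Γ w) → ReducedWord (a :: w)

/-- An exchange property: two descents are equal or adjacent, so `a` commutes past the leading
letters until it meets its own occurrence. -/
theorem ReducedWord.exists_of_isDescent {w : List (V × Bool)} (h : ReducedWord Γ w)
    {a : V × Bool} (ha : IsDescent Γ a (word Γ w)) :
    ∃ u, ReducedWord Γ u ∧ word Γ w = letter Γ a * word Γ u ∧ u.length + 1 = w.length := by
  induction h with
  | nil => exact (not_isDescent_one a (by simpa using ha)).elim
  | cons b u hu hb ih =>
    have hbu : IsDescent Γ b (word Γ (b :: u)) := by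
      rw [word_cons, isDescent_letter_mul_self]; exact hb
    rcases ha.eq_or_adj hbu with rfl | hab
    · exact ⟨u, hu, word_cons Γ a u, rfl⟩
    · rw [word_cons, isDescent_letter_mul_of_adj hab] at ha
      obtain ⟨x, hx, hux, hl⟩ := ih ha
      refine ⟨b :: x, .cons b x hx ?_, ?_, by simp [hl]⟩
      · rwa [hux, isDescent_letter_mul_of_adj (a := letterInv b) hab.symm] at hb
      · rw [word_cons, word_cons, hux, ← mul_assoc, ← mul_assoc, (letter_commute Γ hab).eq]

theorem exists_reducedWord (g : RAAG Γ) : ∃ w, ReducedWord Γ w ∧ word Γ w = g := by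
  obtain ⟨w, rfl⟩ := exists_word Γ g
  induction w with
  | nil => exact ⟨[], .nil, rfl⟩
  | cons a w ih =>
    obtain ⟨u, hu, huw⟩ := ih
    rw [word_cons, ← huw]
    by_cases h : IsDescent Γ (letterInv a) (word Γ u)
    · obtain ⟨x, hx, hux, -⟩ := hu.exists_of_isDescent h
      exact ⟨x, hx, by rw [hux]; simp⟩
    · exact ⟨a :: u, .cons a u hu h, word_cons Γ a u⟩

theorem word_inv (w : List (V × Bool)) : (word Γ w)⁻¹ = word Γ (w.reverse.map letterInv) := by
  induction w with
  | nil => simp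
  | cons a w ih => simp [ih]

theorem isDescent_letter_iff {a b : V × Bool} : IsDescent Γ a (letter Γ b) ↔ a = b := by
  have hb : IsDescent Γ b (letter Γ b) := by
    simpa [not_isDescent_one] using isDescent_letter_mul_self (Γ := Γ) b 1
  refine ⟨fun h => (h.eq_or_adj hb).resolve_right fun hab => ?_, fun h => h ▸ hb⟩
  exact not_isDescent_one a ((isDescent_letter_mul_of_adj hab 1).mp (by simpa using h))

theorem letter_injective : Function.Injective (letter Γ) := fun _ _ h =>
  isDescent_letter_iff.mp (h ▸ isDescent_letter_iff.mpr rfl)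

theorem exists_isDescent {g : RAAG Γ} (h : g ≠ 1) : ∃ a, IsDescent Γ a g := by
  obtain ⟨w, hw, rfl⟩ := exists_reducedWord g
  cases hw with
  | nil => exact (h rfl).elim
  | cons a w _ ha => exact ⟨a, by rwa [word_cons, isDescent_letter_mul_self]⟩

variable (Γ) in
/-- The length of an element: its number of letters in the diagonal coordinates. -/
noncomputable def len [Fintype V] (g : RAAG Γ) : ℕ := ∑ v, (state Γ g (v, v)).length

variable [Fintype V]

@[simp] theorem len_one : len Γ 1 = 0 := by simp [len]

theorem len_letter_mul_of_not_isDescent {a : V × Bool} {g : RAAG Γ}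
    (h : ¬ IsDescent Γ (letterInv a) g) : len Γ (letter Γ a * g) = len Γ g + 1 := by
  classical
  rw [len, len, state_letter_mul, push_of_not_heads Γ h]
  have : ∀ v, (consLetter Γ a (state Γ g) (v, v)).length =
      (state Γ g (v, v)).length + if v = a.1 then 1 else 0 := by
    intro v
    simp only [consLetter, acts_diag]
    split_ifs <;> simp
  simp [this, Finset.sum_add_distrib]

theorem len_letter_mul_of_isDescent {a : V × Bool} {g : RAAG Γ}
    (h : IsDescent Γ (letterInv a) g) : len Γ (letter Γ a * g) + 1 = len Γ g := by
  have h1 : ¬ IsDescent Γ (letterInv (letterInv a)) (letter Γ a * g) := by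
    rw [letterInv_letterInv, isDescent_letter_mul_self, not_not]; exact h
  simpa using (len_letter_mul_of_not_isDescent h1).symm

theorem isDescent_iff_len {a : V × Bool} {g : RAAG Γ} :
    IsDescent Γ a g ↔ len Γ ((letter Γ a)⁻¹ * g) < len Γ g := by
  rw [← letter_letterInv]
  by_cases h : IsDescent Γ a g
  · have := len_letter_mul_of_isDescent (a := letterInv a) (g := g) (by simpa using h)
    simp only [h, true_iff]; omega
  · have := len_letter_mul_of_not_isDescent (a := letterInv a) (g := g) (by simpa using h)
    simp only [h, false_iff]; omega

theorem len_letter_mul_le (a : V × Bool) (g : RAAG Γ) : len Γ (letter Γ a * g) ≤ len Γ g + 1 := by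
  by_cases h : IsDescent Γ (letterInv a) g
  · have := len_letter_mul_of_isDescent h; omega
  · exact (len_letter_mul_of_not_isDescent h).le

theorem len_word_le (w : List (V × Bool)) : len Γ (word Γ w) ≤ w.length := by
  induction w with
  | nil => simp
  | cons a w ih =>
    have := len_letter_mul_le a (word Γ w)
    rw [word_cons, List.length_cons]; omega

theorem ReducedWord.len_eq {w : List (V × Bool)} (h : ReducedWord Γ w) :
    len Γ (word Γ w) = w.length := by
  induction h with
  | nil => simp
  | cons a w _ ha ih => rw [word_cons, len_letter_mul_of_not_isDescent ha, ih, List.length_cons]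

theorem exists_word_length_eq (g : RAAG Γ) : ∃ w, word Γ w = g ∧ w.length = len Γ g := by
  obtain ⟨w, hw, rfl⟩ := exists_reducedWord g
  exact ⟨w, rfl, hw.len_eq.symm⟩

/-- A letter raises `len` by at most one, so no word is shorter than `len`; a reduced word attains
it. -/
theorem wordLength_gen (g : RAAG Γ) : wordLength (gen Γ) g = len Γ g := by
  obtain ⟨w, hw, hl⟩ := exists_word_length_eq g
  refine le_antisymm (Nat.sInf_le ⟨w, hw, hl⟩) (le_csInf ⟨_, w, hw, hl⟩ ?_)
  rintro _ ⟨u, rfl, rfl⟩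
  exact len_word_le u

theorem len_eq_zero {g : RAAG Γ} : len Γ g = 0 ↔ g = 1 := by
  refine ⟨fun h => ?_, fun h => by rw [h, len_one]⟩
  obtain ⟨w, rfl, hl⟩ := exists_word_length_eq g
  rw [List.length_eq_zero_iff.mp (hl.trans h), word_nil]

theorem state_eq_nil_iff {g : RAAG Γ} : (∀ c, state Γ g c = []) ↔ g = 1 :=
  ⟨fun h => len_eq_zero.mp (by simp [len, h]), fun h => by simp [h]⟩

theorem len_mul_le (g h : RAAG Γ) : len Γ (g * h) ≤ len Γ g + len Γ h := by
  obtain ⟨u, rfl, hu⟩ := exists_word_length_eq g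
  obtain ⟨w, rfl, hw⟩ := exists_word_length_eq h
  rw [← word_append, ← hu, ← hw, ← List.length_append]
  exact len_word_le _

@[simp] theorem len_inv (g : RAAG Γ) : len Γ g⁻¹ = len Γ g := by
  have h : ∀ g : RAAG Γ, len Γ g⁻¹ ≤ len Γ g := by
    intro g
    obtain ⟨u, rfl, hu⟩ := exists_word_length_eq g
    rw [word_inv, ← hu]
    exact (len_word_le _).trans (by simp)
  exact le_antisymm (h g) (by simpa using h g⁻¹)

@[simp] theorem len_letter (a : V × Bool) : len Γ (letter Γ a) = 1 := by
  simpa using len_letter_mul_of_not_isDescent (not_isDescent_one (Γ := Γ) (letterInv a))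

theorem exists_letter_of_len_eq_one {g : RAAG Γ} (h : len Γ g = 1) : ∃ a, letter Γ a = g := by
  obtain ⟨w, rfl, hw⟩ := exists_word_length_eq g
  obtain ⟨a, rfl⟩ := List.length_eq_one_iff.mp (hw.trans h)
  exact ⟨a, by simp⟩

end RAAG

/-! ### Cliques, Foata prefixes and left multiplication -/

namespace RAAG

variable {V : Type*} {Γ : SimpleGraph V}

variable (Γ) in
/-- The letters of the word are at pairwise adjacent vertices. -/
def IsClique (c : List (V × Bool)) : Prop := c.Pairwise fun a b => Γ.Adj a.1 b.1

theorem IsClique.nodup {c : List (V × Bool)} (h : IsClique Γ c) : c.Nodup :=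
  by
  refine List.Pairwise.imp (fun {a b} hab => ?_) h
  rintro rfl
  exact Γ.loopless.irrefl _ hab

theorem IsClique.length_le [Fintype V] {c : List (V × Bool)} (h : IsClique Γ c) :
    c.length ≤ Fintype.card (V × Bool) := h.nodup.length_le_card

theorem IsClique.word_eq_of_perm {c d : List (V × Bool)} (h : IsClique Γ c) (hcd : c.Perm d) :
    word Γ c = word Γ d :=
  (hcd.map _).prod_eq' (List.pairwise_map.mpr (h.imp fun hab => letter_commute Γ hab))

theorem isDescent_word_mul_of_adj {a : V × Bool} {w : List (V × Bool)}
    (h : ∀ b ∈ w, Γ.Adj a.1 b.1) (g : RAAG Γ) :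
    IsDescent Γ a (word Γ w * g) ↔ IsDescent Γ a g := by
  induction w with
  | nil => simp
  | cons b w ih =>
    rw [word_cons, mul_assoc, isDescent_letter_mul_of_adj (h b (by simp)),
      ih fun x hx => h x (by simp [hx])]

theorem isDescent_word_inv_mul_of_adj {a : V × Bool} {w : List (V × Bool)}
    (h : ∀ b ∈ w, Γ.Adj a.1 b.1) (g : RAAG Γ) :
    IsDescent Γ a ((word Γ w)⁻¹ * g) ↔ IsDescent Γ a g := by
  rw [← isDescent_word_mul_of_adj h, mul_inv_cancel_left]

/-- Determines the first Foata factor of the product when nothing cancels: a letter of `g` reaches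
the front only by passing the whole clique. -/
theorem IsClique.isDescent_word_mul {c : List (V × Bool)} (hc : IsClique Γ c) {g : RAAG Γ}
    (hg : ∀ a ∈ c, ¬ IsDescent Γ (letterInv a) g) (a : V × Bool) :
    IsDescent Γ a (word Γ c * g) ↔
      a ∈ c ∨ IsDescent Γ a g ∧ ∀ b ∈ c, Γ.Adj a.1 b.1 := by
  induction c with
  | nil => simp
  | cons b c ih =>
    obtain ⟨hb, hc'⟩ := List.pairwise_cons.mp hc
    have hbc : IsDescent Γ b (letter Γ b * (word Γ c * g)) := by
      rw [isDescent_letter_mul_self, isDescent_word_mul_of_adj (a := letterInv b) hb]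
      exact hg b (by simp)
    have ih := ih hc' fun x hx => hg x (by simp [hx])
    rw [word_cons, mul_assoc]
    by_cases hab : a = b
    · subst hab; simp [hbc]
    · constructor
      · intro h
        have hadj := (h.eq_or_adj hbc).resolve_left hab
        rw [isDescent_letter_mul_of_adj hadj, ih] at h
        rcases h with h | ⟨h1, h2⟩
        · exact Or.inl (by simp [h])
        · refine Or.inr ⟨h1, ?_⟩
          simpa [hadj] using h2
      · intro h
        have hadj : Γ.Adj a.1 b.1 := by
          rcases h with h | ⟨_, h⟩
          · exact (hb a ((List.mem_cons.mp h).resolve_left hab)).symm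
          · exact h b (by simp)
        rw [isDescent_letter_mul_of_adj hadj, ih]
        rcases h with h | ⟨h1, h2⟩
        · exact Or.inl ((List.mem_cons.mp h).resolve_left hab)
        · exact Or.inr ⟨h1, fun x hx => h2 x (by simp [hx])⟩

theorem IsClique.not_isDescent_word_inv_mul {c : List (V × Bool)} (hc : IsClique Γ c)
    {g : RAAG Γ} (hg : ∀ a ∈ c, IsDescent Γ a g) {a : V × Bool} (ha : a ∈ c) :
    ¬ IsDescent Γ (letterInv a) ((word Γ c)⁻¹ * g) := by
  induction c generalizing g with
  | nil => simp at ha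
  | cons b c ih =>
    obtain ⟨hb, hc'⟩ := List.pairwise_cons.mp hc
    rw [word_cons, mul_inv_rev, mul_assoc, ← letter_letterInv]
    rcases List.mem_cons.mp ha with rfl | ha
    · rw [isDescent_word_inv_mul_of_adj (a := letterInv a) hb, isDescent_letter_mul_self,
        letterInv_letterInv, not_not]
      exact hg a (by simp)
    · refine ih hc' (fun x hx => ?_) ha
      rw [isDescent_letter_mul_of_adj (b := letterInv b) (hb x hx).symm]
      exact hg x (by simp [hx])

theorem IsClique.len_word_inv_mul [Fintype V] {c : List (V × Bool)} (hc : IsClique Γ c)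
    {g : RAAG Γ} (hg : ∀ a ∈ c, IsDescent Γ a g) :
    len Γ ((word Γ c)⁻¹ * g) + c.length = len Γ g := by
  induction c generalizing g with
  | nil => simp
  | cons b c ih =>
    obtain ⟨hb, hc'⟩ := List.pairwise_cons.mp hc
    have h1 := len_letter_mul_of_isDescent (a := letterInv b) (g := g)
      (by simpa using hg b (by simp))
    rw [word_cons, mul_inv_rev, mul_assoc, ← letter_letterInv, List.length_cons, ← add_assoc,
      ih hc' fun x hx => ?_, h1]
    rw [isDescent_letter_mul_of_adj (b := letterInv b) (hb x hx).symm]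
    exact hg x (by simp [hx])

section

variable [Fintype V]

variable (Γ) in
open Classical in
/-- The list of left descents. -/
noncomputable def descents (g : RAAG Γ) : List (V × Bool) :=
  (Finset.univ.filter fun a => IsDescent Γ a g).toList

@[simp] theorem mem_descents {g : RAAG Γ} {a : V × Bool} :
    a ∈ descents Γ g ↔ IsDescent Γ a g := by simp [descents]

theorem isClique_descents (g : RAAG Γ) : IsClique Γ (descents Γ g) :=
  (Finset.nodup_toList _).pairwise_of_forall_ne fun a ha b hb hab =>
    (IsDescent.eq_or_adj (g := g) (by simpa using ha) (by simpa using hb)).resolve_left hab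

variable (Γ) in
/-- The greatest product of pairwise commuting letters that divides `g` on the left. -/
noncomputable def cliqueHead (g : RAAG Γ) : RAAG Γ := word Γ (descents Γ g)

variable (Γ) in
/-- What remains of `g` after its clique head. -/
noncomputable def cliqueTail (g : RAAG Γ) : RAAG Γ := (cliqueHead Γ g)⁻¹ * g

@[simp] theorem cliqueHead_mul_cliqueTail (g : RAAG Γ) :
    cliqueHead Γ g * cliqueTail Γ g = g := mul_inv_cancel_left _ _

theorem IsClique.word_eq_cliqueHead {c : List (V × Bool)} (hc : IsClique Γ c) {g : RAAG Γ}
    (h : ∀ a, a ∈ c ↔ IsDescent Γ a g) : word Γ c = cliqueHead Γ g :=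
  hc.word_eq_of_perm ((List.perm_ext_iff_of_nodup hc.nodup (isClique_descents g).nodup).mpr
    fun a => by rw [h, mem_descents])

theorem len_cliqueHead_le (g : RAAG Γ) : len Γ (cliqueHead Γ g) ≤ Fintype.card (V × Bool) :=
  (len_word_le _).trans (isClique_descents g).length_le

theorem len_cliqueTail (g : RAAG Γ) :
    len Γ (cliqueTail Γ g) + (descents Γ g).length = len Γ g :=
  (isClique_descents g).len_word_inv_mul fun _ ha => mem_descents.mp ha

variable (Γ) in
/-- The product of the first `i` factors of the Foata normal form. -/
noncomputable def foataPrefix : ℕ → RAAG Γ → RAAG Γ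
  | 0, _ => 1
  | i + 1, g => cliqueHead Γ g * foataPrefix i (cliqueTail Γ g)

@[simp] theorem foataPrefix_zero (g : RAAG Γ) : foataPrefix Γ 0 g = 1 := rfl

theorem foataPrefix_succ (i : ℕ) (g : RAAG Γ) :
    foataPrefix Γ (i + 1) g = cliqueHead Γ g * foataPrefix Γ i (cliqueTail Γ g) := rfl

theorem exists_foataPrefix_succ (i : ℕ) (g : RAAG Γ) :
    ∃ s, len Γ s ≤ Fintype.card (V × Bool) ∧ foataPrefix Γ (i + 1) g = foataPrefix Γ i g * s := by
  induction i generalizing g with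
  | zero => exact ⟨cliqueHead Γ g, len_cliqueHead_le g, by simp [foataPrefix_succ]⟩
  | succ i ih =>
    obtain ⟨s, hs, h⟩ := ih (cliqueTail Γ g)
    exact ⟨s, hs, by rw [foataPrefix_succ, h, ← mul_assoc, ← foataPrefix_succ]⟩

/-- A nontrivial element has a descent, so each factor uses up at least one letter. -/
theorem foataPrefix_of_len_le {i : ℕ} {g : RAAG Γ} (h : len Γ g ≤ i) : foataPrefix Γ i g = g := by
  induction i generalizing g with
  | zero => rw [len_eq_zero.mp (Nat.le_zero.mp h), foataPrefix_zero]
  | succ i ih =>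
    have h1 := len_cliqueTail g
    rw [foataPrefix_succ, ih, cliqueHead_mul_cliqueTail]
    by_cases hg : g = 1
    · subst hg; simp at h1; simp [h1.1]
    · obtain ⟨a, ha⟩ := exists_isDescent hg
      have := List.length_pos_of_mem (mem_descents.mpr ha)
      omega

/-- The discrepancy stays a single clique. The clique `c` displaces from the first factor the
descents of `g` that do not pass it; these again form a clique, standing in front of the tail, where
the argument repeats. So the bound does not grow with `i`. -/
theorem IsClique.len_foataPrefix_word_mul {c : List (V × Bool)} (hc : IsClique Γ c) {g : RAAG Γ}
    (hg : ∀ a ∈ c, ¬ IsDescent Γ (letterInv a) g) (i : ℕ) :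
    len Γ ((word Γ c * foataPrefix Γ i g)⁻¹ * foataPrefix Γ i (word Γ c * g)) ≤
      Fintype.card (V × Bool) := by
  classical
  induction i generalizing c g with
  | zero => simpa using (len_word_le c).trans hc.length_le
  | succ i ih =>
    -- `e` joins `c` in the first factor; `f` is delayed to the next one and replaces `c` in the
    -- induction.
    set e := (descents Γ g).filter fun a => ∀ b ∈ c, Γ.Adj a.1 b.1 with he
    set f := (descents Γ g).filter fun a => !decide (∀ b ∈ c, Γ.Adj a.1 b.1)
    have hef : (e ++ f).Perm (descents Γ g) := List.filter_append_perm _ _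
    have hgD : word Γ (e ++ f) = cliqueHead Γ g :=
      ((isClique_descents g).word_eq_of_perm hef.symm).symm
    have hecl : IsClique Γ e := (isClique_descents g).sublist List.filter_sublist
    have hfcl : IsClique Γ f := (isClique_descents g).sublist List.filter_sublist
    have hce : IsClique Γ (c ++ e) := by
      refine List.pairwise_append.mpr ⟨hc, hecl, fun a ha b hb => ?_⟩
      have := (List.mem_filter.mp hb).2
      simp only [decide_eq_true_eq] at this
      exact (this a ha).symm
    have hceD : word Γ (c ++ e) = cliqueHead Γ (word Γ c * g) := by
      refine hce.word_eq_cliqueHead fun a => ?_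
      rw [hc.isDescent_word_mul hg, List.mem_append, he, List.mem_filter, mem_descents,
        decide_eq_true_eq]
    have htail : cliqueTail Γ (word Γ c * g) = word Γ f * cliqueTail Γ g := by
      rw [cliqueTail, cliqueTail, ← hceD, ← hgD, word_append, word_append]
      group
    have hft : ∀ a ∈ f, ¬ IsDescent Γ (letterInv a) (cliqueTail Γ g) := fun a ha =>
      (isClique_descents g).not_isDescent_word_inv_mul (fun _ h => mem_descents.mp h)
        (List.mem_of_mem_filter ha)
    have key := ih hfcl hft
    rw [foataPrefix_succ, foataPrefix_succ, htail, ← hceD, ← hgD, word_append, word_append]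
    convert key using 2
    group

theorem len_foataPrefix_letter_mul (a : V × Bool) (g : RAAG Γ) (i : ℕ) :
    len Γ ((letter Γ a * foataPrefix Γ i g)⁻¹ * foataPrefix Γ i (letter Γ a * g)) ≤
      Fintype.card (V × Bool) := by
  have hcl : ∀ a : V × Bool, IsClique Γ [a] := fun a => List.pairwise_singleton _ _
  by_cases h : IsDescent Γ (letterInv a) g
  -- If `a` cancels, its inverse does not cancel against `letter Γ a * g`; the resulting difference
  -- is the inverse of the wanted one.
  · have h1 : ∀ b ∈ [letterInv a], ¬ IsDescent Γ (letterInv b) (letter Γ a * g) := by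
      simpa [isDescent_letter_mul_self] using h
    have := (hcl (letterInv a)).len_foataPrefix_word_mul h1 i
    rw [← len_inv] at this
    convert this using 2
    simp [mul_assoc]
  · simpa using (hcl a).len_foataPrefix_word_mul (g := g) (by simpa using h) i

theorem len_foataPrefix_word_mul (w : List (V × Bool)) (g : RAAG Γ) (i : ℕ) :
    len Γ ((word Γ w * foataPrefix Γ i g)⁻¹ * foataPrefix Γ i (word Γ w * g)) ≤
      Fintype.card (V × Bool) * w.length := by
  induction w with
  | nil => simp
  | cons a w ih =>
    have h1 := len_foataPrefix_letter_mul a (word Γ w * g) i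
    have h2 := len_mul_le ((word Γ w * foataPrefix Γ i g)⁻¹ * foataPrefix Γ i (word Γ w * g))
      ((letter Γ a * foataPrefix Γ i (word Γ w * g))⁻¹ *
        foataPrefix Γ i (letter Γ a * (word Γ w * g)))
    rw [List.length_cons, mul_add, mul_one]
    refine le_trans (le_of_eq ?_) (h2.trans (add_le_add ih h1))
    congr 1
    simp only [word_cons, mul_assoc, mul_inv_rev, mul_inv_cancel_left]

end

/-! ### Right multiplication and Foata prefixes -/

variable (Γ) in
/-- All letters of `g` are at vertices adjacent to `v`. -/
def SupportAdj (v : V) (g : RAAG Γ) : Prop := ∀ t, ¬ Γ.Adj v t → state Γ g (t, t) = []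

theorem supportAdj_letter_mul {v : V} {a : V × Bool} (h : Γ.Adj v a.1) (g : RAAG Γ) :
    SupportAdj Γ v (letter Γ a * g) ↔ SupportAdj Γ v g := by
  refine forall₂_congr fun t ht => ?_
  have : ¬ Acts Γ a.1 (t, t) := by
    rw [acts_diag]; rintro rfl; exact ht h
  rw [state_letter_mul, push]
  split_ifs <;> simp [tailLetter, consLetter, this]

theorem SupportAdj.adj {v : V} {g : RAAG Γ} (h : SupportAdj Γ v g) {a : V × Bool}
    (ha : IsDescent Γ a g) : Γ.Adj v a.1 := by
  by_contra hv
  have := ha _ (acts_self Γ a.1)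
  rw [h _ hv] at this
  simp at this

theorem supportAdj_word_mul {v : V} {w : List (V × Bool)} (h : ∀ a ∈ w, Γ.Adj v a.1)
    (g : RAAG Γ) : SupportAdj Γ v (word Γ w * g) ↔ SupportAdj Γ v g := by
  induction w with
  | nil => simp
  | cons a w ih =>
    rw [word_cons, mul_assoc, supportAdj_letter_mul (h a (by simp)),
      ih fun b hb => h b (by simp [hb])]

theorem supportAdj_one (v : V) : SupportAdj Γ v 1 := by simp [SupportAdj]

/-- Induction on an element by removing left descents. -/
theorem descent_induction {p : RAAG Γ → Prop} (one : p 1)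
    (mul : ∀ a g, ¬ IsDescent Γ (letterInv a) g → p g → p (letter Γ a * g)) (g : RAAG Γ) :
    p g := by
  obtain ⟨w, hw, rfl⟩ := exists_reducedWord g
  induction hw with
  | nil => exact one
  | cons a w _ ha ih => rw [word_cons]; exact mul a _ ha ih

theorem SupportAdj.commute {a : V × Bool} {g : RAAG Γ} (h : SupportAdj Γ a.1 g) :
    Commute (letter Γ a) g := by
  induction g using descent_induction with
  | one => exact Commute.one_right _
  | mul b g hb ih =>
    have hab := h.adj ((isDescent_letter_mul_self b g).mpr hb)
    exact (letter_commute Γ hab).mul_right (ih ((supportAdj_letter_mul hab g).mp h))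

variable [Fintype V]

theorem SupportAdj.cliqueTail {v : V} {g : RAAG Γ} (h : SupportAdj Γ v g) :
    SupportAdj Γ v (cliqueTail Γ g) := by
  rwa [← supportAdj_word_mul (w := descents Γ g) fun a ha => h.adj (mem_descents.mp ha),
    ← cliqueHead, cliqueHead_mul_cliqueTail]

theorem SupportAdj.foataPrefix {v : V} {g : RAAG Γ} (h : SupportAdj Γ v g) (i : ℕ) :
    SupportAdj Γ v (foataPrefix Γ i g) := by
  induction i generalizing g with
  | zero => exact supportAdj_one v
  | succ i ih =>
    rw [foataPrefix_succ, cliqueHead, supportAdj_word_mul fun a ha => h.adj (mem_descents.mp ha)]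
    exact ih h.cliqueTail

/-- The leading letter `x` of `g` remains a descent after the lengthening by `b`, and it differs
from `a`, so it is adjacent to `a`. Stripping such letters leaves `b` alone. -/
theorem supportAdj_of_isDescent_mul {a b : V × Bool} {g : RAAG Γ} (h : ¬ IsDescent Γ a g)
    (hb : IsDescent Γ a (g * letter Γ b)) (hl : len Γ g < len Γ (g * letter Γ b)) :
    a = b ∧ SupportAdj Γ a.1 g := by
  induction g using descent_induction with
  | one => exact ⟨isDescent_letter_iff.mp (by simpa using hb), supportAdj_one _⟩
  | mul x g hx ih =>
    have h1 := (isDescent_letter_mul_self x g).mpr hx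
    have hlx := len_letter_mul_of_not_isDescent hx
    rw [mul_assoc] at hb hl
    have h3 := len_letter_mul_le x (g * letter Γ b)
    have hxa : IsDescent Γ x (letter Γ x * (g * letter Γ b)) := by
      rw [isDescent_letter_mul_self]
      intro h2
      have h4 := len_letter_mul_of_isDescent h2
      have := len_mul_le g (letter Γ b)
      rw [len_letter] at this
      omega
    have hadj : Γ.Adj a.1 x.1 := (hb.eq_or_adj hxa).resolve_left fun hax => h (hax ▸ h1)
    rw [isDescent_letter_mul_of_adj hadj] at h hb
    obtain ⟨h5, h6⟩ := ih h hb (by omega)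
    exact ⟨h5, (supportAdj_letter_mul hadj g).mpr h6⟩

theorem len_mul_letter (g : RAAG Γ) (a : V × Bool) :
    len Γ (g * letter Γ a) = len Γ g + 1 ∨ len Γ (g * letter Γ a) + 1 = len Γ g := by
  have h : len Γ (g * letter Γ a) = len Γ (letter Γ (letterInv a) * g⁻¹) := by
    rw [← len_inv]; simp
  rw [h, ← len_inv g]
  by_cases hd : IsDescent Γ (letterInv (letterInv a)) g⁻¹
  · exact Or.inr (len_letter_mul_of_isDescent hd)
  · exact Or.inl (len_letter_mul_of_not_isDescent hd)

theorem IsDescent.mul_letter {a b : V × Bool} {g : RAAG Γ} (h : IsDescent Γ a g)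
    (hl : len Γ g < len Γ (g * letter Γ b)) : IsDescent Γ a (g * letter Γ b) := by
  rw [isDescent_iff_len] at h ⊢
  have := len_mul_le ((letter Γ a)⁻¹ * g) (letter Γ b)
  rw [len_letter, mul_assoc] at this
  omega

/-- Either `b` enters the first factor, and then it commutes with all of `g` and leaves the later
factors alone, or the first factor is unchanged and `b` passes to the tail. -/
theorem len_foataPrefix_mul_letter_of_lt {b : V × Bool} {g : RAAG Γ}
    (hl : len Γ g < len Γ (g * letter Γ b)) (i : ℕ) :
    len Γ ((foataPrefix Γ i g)⁻¹ * foataPrefix Γ i (g * letter Γ b)) ≤ 1 := by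
  induction i generalizing g with
  | zero => simp
  | succ i ih =>
    by_cases hd : ∃ a, ¬ IsDescent Γ a g ∧ IsDescent Γ a (g * letter Γ b)
    · obtain ⟨a, ha, hab⟩ := hd
      obtain ⟨rfl, hs⟩ := supportAdj_of_isDescent_mul ha hab hl
      have hcl : IsClique Γ (a :: descents Γ g) :=
        List.pairwise_cons.mpr ⟨fun x hx => hs.adj (mem_descents.mp hx), isClique_descents g⟩
      have hD : word Γ (a :: descents Γ g) = cliqueHead Γ (g * letter Γ a) := by
        refine hcl.word_eq_cliqueHead fun x => ?_
        rw [List.mem_cons, mem_descents]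
        refine ⟨?_, fun h => ?_⟩
        · rintro (rfl | h)
          · exact hab
          · exact h.mul_letter hl
        · by_contra! hx
          exact hx.1 (supportAdj_of_isDescent_mul hx.2 h hl).1
      have hT : cliqueTail Γ (g * letter Γ a) = cliqueTail Γ g := by
        rw [cliqueTail, ← hD, word_cons, ← hs.commute.eq, cliqueTail, cliqueHead]
        group
      have hc := ((hs.cliqueTail.foataPrefix i).commute).eq
      have hc2 : Commute (letter Γ a) (cliqueHead Γ g) := by
        have := hs.commute.mul_right hs.cliqueTail.commute.inv_right
        rwa [cliqueTail, mul_inv_rev, inv_inv, mul_inv_cancel_left] at this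
      rw [foataPrefix_succ, foataPrefix_succ, hT, ← hD, word_cons, ← cliqueHead, hc2.eq, mul_assoc,
        hc, ← mul_assoc (cliqueHead Γ g), inv_mul_cancel_left, len_letter]
    · push Not at hd
      have hD : cliqueHead Γ (g * letter Γ b) = cliqueHead Γ g :=
        ((isClique_descents g).word_eq_cliqueHead fun a => by
          rw [mem_descents]
          exact ⟨fun h => h.mul_letter hl, fun h => by_contra fun h' => hd a h' h⟩).symm
      have hT : cliqueTail Γ (g * letter Γ b) = cliqueTail Γ g * letter Γ b := by
        rw [cliqueTail, hD, cliqueTail, mul_assoc]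
      have hl' : len Γ (cliqueTail Γ g) < len Γ (cliqueTail Γ g * letter Γ b) := by
        rw [← hT]
        have h1 := len_cliqueTail g
        have h2 := len_mul_le (cliqueHead Γ g) (cliqueTail Γ (g * letter Γ b))
        rw [← hD, cliqueHead_mul_cliqueTail] at h2
        have h3 := len_word_le (Γ := Γ) (descents Γ g)
        rw [← cliqueHead, ← hD] at h3
        omega
      rw [foataPrefix_succ, foataPrefix_succ, hD, hT]
      convert ih hl' using 2
      group

theorem len_foataPrefix_mul_letter (b : V × Bool) (g : RAAG Γ) (i : ℕ) :
    len Γ ((foataPrefix Γ i g)⁻¹ * foataPrefix Γ i (g * letter Γ b)) ≤ 1 := by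
  rcases len_mul_letter g b with h | h
  · exact len_foataPrefix_mul_letter_of_lt (by omega) i
  · have := len_foataPrefix_mul_letter_of_lt (b := letterInv b) (g := g * letter Γ b)
      (by simp; omega) i
    rw [← len_inv] at this
    simpa using this

theorem len_foataPrefix_mul_word (w : List (V × Bool)) (g : RAAG Γ) (i : ℕ) :
    len Γ ((foataPrefix Γ i g)⁻¹ * foataPrefix Γ i (g * word Γ w)) ≤ w.length := by
  induction w generalizing g with
  | nil => simp
  | cons b w ih =>
    have h1 := len_mul_le ((foataPrefix Γ i g)⁻¹ * foataPrefix Γ i (g * letter Γ b))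
      ((foataPrefix Γ i (g * letter Γ b))⁻¹ * foataPrefix Γ i (g * letter Γ b * word Γ w))
    have h2 := len_foataPrefix_mul_letter b g i
    have h3 := ih (g * letter Γ b)
    rw [mul_assoc, mul_inv_cancel_left, mul_assoc] at h1
    rw [mul_assoc] at h3
    rw [word_cons, List.length_cons]
    omega

end RAAG

/-! ### Twisted conjugacy and short conjugators -/

namespace RAAG

variable {V : Type*} {Γ : SimpleGraph V} [Fintype V]

section

variable {ψ : MulAut (RAAG Γ)}

/-- The letters are the elements of length one, and there are finitely many. -/
theorem exists_letter_map (hψ : ∀ g, len Γ (ψ g) = len Γ g) :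
    ∃ f : V × Bool → V × Bool, Function.Bijective f ∧ ∀ a, letter Γ (f a) = ψ (letter Γ a) := by
  choose f hf using fun a => exists_letter_of_len_eq_one ((hψ (letter Γ a)).trans (len_letter a))
  refine ⟨f, Finite.injective_iff_bijective.mp fun a b hab => ?_, hf⟩
  exact letter_injective (ψ.injective (by rw [← hf, ← hf, hab]))

/-- By `isDescent_iff_len`, descents depend on length alone, so the permutation of letters carries
descents to descents. -/
theorem map_cliqueHead (hψ : ∀ g, len Γ (ψ g) = len Γ g) (g : RAAG Γ) :
    ψ (cliqueHead Γ g) = cliqueHead Γ (ψ g) := by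
  obtain ⟨f, hf, h⟩ := exists_letter_map hψ
  have hd : ∀ a, IsDescent Γ (f a) (ψ g) ↔ IsDescent Γ a g := fun a => by
    rw [isDescent_iff_len, isDescent_iff_len, h, ← map_inv, ← map_mul, hψ, hψ]
  have hm : ∀ a, a ∈ (descents Γ g).map f ↔ IsDescent Γ a (ψ g) := fun a => by
    obtain ⟨b, rfl⟩ := hf.2 a
    rw [List.mem_map_of_injective hf.1, mem_descents, hd]
  have hc : IsClique Γ ((descents Γ g).map f) :=
    ((isClique_descents g).nodup.map hf.1).pairwise_of_forall_ne fun a ha b hb hab =>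
      (((hm a).mp ha).eq_or_adj ((hm b).mp hb)).resolve_left hab
  rw [← hc.word_eq_cliqueHead hm, cliqueHead, word, word, map_list_prod, List.map_map, List.map_map]
  congr 2
  exact funext fun a => (h a).symm

theorem map_foataPrefix (hψ : ∀ g, len Γ (ψ g) = len Γ g) (i : ℕ) (g : RAAG Γ) :
    ψ (foataPrefix Γ i g) = foataPrefix Γ i (ψ g) := by
  induction i generalizing g with
  | zero => simp
  | succ i ih =>
    rw [foataPrefix_succ, foataPrefix_succ, map_mul, map_cliqueHead hψ, ih, cliqueTail, cliqueTail,
      map_mul, map_inv, map_cliqueHead hψ]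

/-- Compare both sides with the prefix of the common element `u * h = g * ψ u`: the right factor `h`
costs its length, the left factor `g` costs the number of letters times its length. -/
theorem len_foataPrefix_conj_le (hψ : ∀ g, len Γ (ψ g) = len Γ g) {g h u : RAAG Γ}
    (hu : u * h = g * ψ u) (i : ℕ) :
    len Γ ((foataPrefix Γ i u)⁻¹ * g * ψ (foataPrefix Γ i u)) ≤
      Fintype.card (V × Bool) * len Γ g + len Γ h := by
  obtain ⟨w, rfl, hw⟩ := exists_word_length_eq g
  obtain ⟨x, rfl, hx⟩ := exists_word_length_eq h
  have h1 := len_foataPrefix_mul_word x u i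
  have h2 := len_foataPrefix_word_mul w (ψ u) i
  rw [← hu, ← len_inv, mul_inv_rev, inv_inv] at h2
  have h3 := len_mul_le ((foataPrefix Γ i u)⁻¹ * foataPrefix Γ i (u * word Γ x))
    ((foataPrefix Γ i (u * word Γ x))⁻¹ * (word Γ w * foataPrefix Γ i (ψ u)))
  rw [mul_assoc, mul_inv_cancel_left, ← mul_assoc] at h3
  rw [map_foataPrefix hψ, ← hw, ← hx]
  omega

end

variable (Γ) in
/-- The elements of length at most `R`. -/
abbrev Ball (R : ℕ) := {g : RAAG Γ // len Γ g ≤ R}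

theorem exists_ball_injection (R : ℕ) :
    ∃ f : Ball Γ R → (Fin R → Option (V × Bool)), Function.Injective f := by
  choose w hw hl using fun g : RAAG Γ => exists_word_length_eq g
  refine ⟨fun g i => (w g.1)[(i : ℕ)]?, fun g h hgh => Subtype.ext ?_⟩
  rw [← hw g.1, ← hw h.1]
  congr 1
  refine List.ext_getElem? fun i => ?_
  by_cases hi : i < R
  · exact congrFun hgh ⟨i, hi⟩
  · have := g.2
    have := h.2
    rw [List.getElem?_eq_none (by rw [hl]; omega), List.getElem?_eq_none (by rw [hl]; omega)]

instance finite_ball (R : ℕ) : Finite (Ball Γ R) :=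
  let ⟨f, hf⟩ := exists_ball_injection (Γ := Γ) R
  Finite.of_injective f hf

theorem card_ball_le (R : ℕ) : Nat.card (Ball Γ R) ≤ (Fintype.card (V × Bool) + 1) ^ R := by
  obtain ⟨f, hf⟩ := exists_ball_injection (Γ := Γ) R
  refine (Nat.card_le_card_of_injective f hf).trans (le_of_eq ?_)
  simp

/-- Elements of the ball of radius `R` that are twisted conjugate by an element of length at most
`C`. -/
def twistedGraph (ψ : MulAut (RAAG Γ)) (C R : ℕ) : SimpleGraph (Ball Γ R) :=
  SimpleGraph.fromRel fun x y => ∃ s, len Γ s ≤ C ∧ y.1 = s⁻¹ * x.1 * ψ s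

variable {ψ : MulAut (RAAG Γ)} {C R : ℕ}

theorem exists_of_twistedGraph_walk {x y : Ball Γ R} (p : (twistedGraph ψ C R).Walk x y) :
    ∃ s, len Γ s ≤ C * p.length ∧ y.1 = s⁻¹ * x.1 * ψ s := by
  induction p with
  | nil => exact ⟨1, by simp, by simp⟩
  | @cons x y z h p ih =>
    obtain ⟨s, hs, hz⟩ := ih
    have hst : ∃ t, len Γ t ≤ C ∧ y.1 = t⁻¹ * x.1 * ψ t := by
      rcases (SimpleGraph.fromRel_adj _ _ _).mp h with ⟨-, h | ⟨t, ht, hx⟩⟩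
      · exact h
      · exact ⟨t⁻¹, by simpa using ht, by rw [hx, map_inv]; group⟩
    obtain ⟨t, ht, hy⟩ := hst
    refine ⟨t * s, (len_mul_le t s).trans ?_, by rw [hz, hy, map_mul]; group⟩
    rw [SimpleGraph.Walk.length_cons, mul_add, mul_one]
    omega

/-- Twisted conjugate elements are twisted conjugate by an element of bounded length. -/
theorem exists_short_twisted_conjugator (hψ : ∀ g, len Γ (ψ g) = len Γ g) {g h u : RAAG Γ}
    (hu : u * h = g * ψ u) :
    ∃ s, s * h = g * ψ s ∧ len Γ s ≤ Fintype.card (V × Bool) *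
      (Fintype.card (V × Bool) + 1) ^ (Fintype.card (V × Bool) * len Γ g + len Γ h) := by
  classical
  set C := Fintype.card (V × Bool)
  set R := C * len Γ g + len Γ h
  let x : ℕ → Ball Γ R := fun i =>
    ⟨(foataPrefix Γ i u)⁻¹ * g * ψ (foataPrefix Γ i u), len_foataPrefix_conj_le hψ hu i⟩
  have hreach : ∀ i, (twistedGraph ψ C R).Reachable (x 0) (x i) := by
    intro i
    induction i with
    | zero => exact SimpleGraph.Reachable.refl _
    | succ i ih =>
      refine ih.trans ?_
      -- The graph has no loops, so a stationary step is treated apart.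
      by_cases hne : x i = x (i + 1)
      · rw [hne]
      · obtain ⟨s, hs, hsi⟩ := exists_foataPrefix_succ i u
        refine SimpleGraph.Adj.reachable ((SimpleGraph.fromRel_adj _ _ _).mpr
          ⟨hne, Or.inl ⟨s, hs, ?_⟩⟩)
        simp only [x, hsi, map_mul]
        group
  -- By then the prefix is all of `u`, so the walk ends at `u⁻¹ * g * ψ u = h`.
  obtain ⟨p⟩ := hreach (len Γ u)
  have := Fintype.ofFinite (Ball Γ R)
  -- A path repeats no vertex: its length is bounded by the size of the ball, independently of `u`.
  have hp := (p.toPath.2.length_lt).le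
  rw [← Nat.card_eq_fintype_card] at hp
  obtain ⟨s, hs, hx⟩ := exists_of_twistedGraph_walk p.toPath.1
  refine ⟨s, ?_, hs.trans (Nat.mul_le_mul_left _ (hp.trans (card_ball_le R)))⟩
  simp only [x, foataPrefix_zero, foataPrefix_of_len_le le_rfl, mul_assoc, ← hu] at hx
  simp at hx
  rw [hx, mul_inv_cancel_left]

end RAAG

/-! ### Bounded search for conjugators -/

theorem PrimrecPred.of_finite {α : Type*} [Primcodable α] [Finite α] (p : α → Prop) :
    PrimrecPred p := by
  classical
  exact ⟨inferInstance, Primrec.dom_finite _⟩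

section Words

/-- The words of length at most `n` over a finite alphabet. -/
def wordsUpTo {α : Type*} (l : List α) (n : ℕ) : List (List α) :=
  Nat.rec [[]] (fun _ L => [] :: L.flatMap fun w => l.map fun a => a :: w) n

theorem mem_wordsUpTo {α : Type*} {l : List α} (hl : ∀ a, a ∈ l) {n : ℕ} {w : List α}
    (h : w.length ≤ n) : w ∈ wordsUpTo l n := by
  induction n generalizing w with
  | zero =>
    rw [List.length_eq_zero_iff.mp (Nat.le_zero.mp h)]
    exact List.mem_singleton_self _
  | succ n ih =>
    cases w with
    | nil => exact List.mem_cons_self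
    | cons a w =>
      refine List.mem_cons_of_mem _ (List.mem_flatMap.mpr ⟨w, ih ?_, ?_⟩)
      · simpa using h
      · exact List.mem_map_of_mem (hl a)

theorem primrec_wordsUpTo {α : Type*} [Primcodable α] (l : List α) : Primrec (wordsUpTo l) := by
  have h2 : Primrec₂ fun (_ : Unit) (p : ℕ × List (List α)) =>
      [] :: p.2.flatMap fun w => l.map fun a => a :: w := by
    refine Primrec.list_cons.comp (Primrec.const []) (Primrec.list_flatMap
      (Primrec.snd.comp Primrec.snd) ?_)
    refine Primrec.list_map (Primrec.const l) ?_
    exact Primrec.list_cons.comp Primrec.snd (Primrec.snd.comp Primrec.fst)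
  exact (Primrec.nat_rec (Primrec.const [[]]) h2).comp (Primrec.const ()) Primrec.id

variable {ι G : Type*} [Group G] (x : ι → G)

@[simp] theorem wordValue_append (u w : List (ι × Bool)) :
    wordValue x (u ++ w) = wordValue x u * wordValue x w := by simp [wordValue]

theorem wordValue_reverse_map (w : List (ι × Bool)) :
    wordValue x (w.reverse.map fun a => (a.1, !a.2)) = (wordValue x w)⁻¹ := by
  induction w with
  | nil => simp [wordValue]
  | cons a w ih =>
    rw [List.reverse_cons, List.map_append, wordValue_append, ih]
    rcases a with ⟨i, _ | _⟩ <;> simp [wordValue]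

theorem exists_wordValue_eq (hx : Subgroup.closure (Set.range x) = ⊤) (g : G) :
    ∃ w, wordValue x w = g := by
  have hg : g ∈ Subgroup.closure (Set.range x) := hx ▸ Subgroup.mem_top g
  induction hg using Subgroup.closure_induction with
  | mem _ h => obtain ⟨i, rfl⟩ := h; exact ⟨[(i, true)], by simp [wordValue]⟩
  | one => exact ⟨[], rfl⟩
  | mul _ _ _ _ hu hw =>
    obtain ⟨u, rfl⟩ := hu
    obtain ⟨w, rfl⟩ := hw
    exact ⟨u ++ w, wordValue_append x u w⟩
  | inv _ _ hu => obtain ⟨u, rfl⟩ := hu; exact ⟨_, wordValue_reverse_map x u⟩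

/-- Conjugacy is decidable if the word problem is, and conjugators have computably bounded
length. -/
theorem computablePred_isConj [Primcodable ι] [Finite ι]
    (hwp : PrimrecPred fun w => wordValue x w = 1) {B : ℕ → ℕ} (hB : Primrec B)
    (hconj : ∀ u w, IsConj (wordValue x u) (wordValue x w) →
      ∃ s : List (ι × Bool), s.length ≤ B (u.length + w.length) ∧
        wordValue x s * wordValue x u * (wordValue x s)⁻¹ = wordValue x w) :
    ComputablePred fun p : List (ι × Bool) × List (ι × Bool) =>
      IsConj (wordValue x p.1) (wordValue x p.2) := by
  have := Fintype.ofFinite ι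
  let inv : List (ι × Bool) → List (ι × Bool) := fun w => w.reverse.map fun a => (a.1, !a.2)
  have hinv : Primrec inv := Primrec.list_map Primrec.list_reverse
    (Primrec.pair (Primrec.fst.comp Primrec.snd) (Primrec.not.comp (Primrec.snd.comp Primrec.snd)))
  let l : List (ι × Bool) := Finset.univ.toList
  -- Testing one candidate conjugator is an instance of the word problem.
  have hR : PrimrecRel fun (s : List (ι × Bool)) (p : List (ι × Bool) × List (ι × Bool)) =>
      wordValue x (s ++ p.1 ++ inv s ++ inv p.2) = 1 := by
    refine hwp.comp (f := fun q : List (ι × Bool) × List (ι × Bool) × List (ι × Bool) =>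
      q.1 ++ q.2.1 ++ inv q.1 ++ inv q.2.2) ?_
    have h1 := Primrec.fst (α := List (ι × Bool)) (β := List (ι × Bool) × List (ι × Bool))
    have h2 := Primrec.snd (α := List (ι × Bool)) (β := List (ι × Bool) × List (ι × Bool))
    exact Primrec.list_append.comp (Primrec.list_append.comp (Primrec.list_append.comp h1
      (Primrec.fst.comp h2)) (hinv.comp h1)) (hinv.comp (Primrec.snd.comp h2))
  have hL : Primrec fun p : List (ι × Bool) × List (ι × Bool) =>
      wordsUpTo l (B (p.1.length + p.2.length)) :=
    (primrec_wordsUpTo l).comp (hB.comp (Primrec.nat_add.comp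
      (Primrec.list_length.comp Primrec.fst) (Primrec.list_length.comp Primrec.snd)))
  have hE : PrimrecPred fun p : List (ι × Bool) × List (ι × Bool) =>
      ∃ s ∈ wordsUpTo l (B (p.1.length + p.2.length)),
        wordValue x (s ++ p.1 ++ inv s ++ inv p.2) = 1 :=
    PrimrecPred.comp (p := fun q : List (List (ι × Bool)) × List (ι × Bool) × List (ι × Bool) =>
      ∃ s ∈ q.1, wordValue x (s ++ q.2.1 ++ inv s ++ inv q.2.2) = 1) hR.exists_mem_list
      (hL.pair Primrec.id)
  have hE' : ComputablePred fun p : List (ι × Bool) × List (ι × Bool) =>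
      ∃ s ∈ wordsUpTo l (B (p.1.length + p.2.length)),
        wordValue x (s ++ p.1 ++ inv s ++ inv p.2) = 1 :=
    hE.computablePred
  refine hE'.of_eq fun p => ?_
  have hval : ∀ s, wordValue x (s ++ p.1 ++ inv s ++ inv p.2) = 1 ↔
      wordValue x s * wordValue x p.1 * (wordValue x s)⁻¹ = wordValue x p.2 := fun s => by
    simp only [wordValue_append, inv, wordValue_reverse_map]
    exact mul_inv_eq_one
  constructor
  · rintro ⟨s, -, hs⟩
    exact isConj_iff.mpr ⟨_, (hval s).mp hs⟩
  · intro h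
    obtain ⟨s, hs, h⟩ := hconj _ _ h
    exact ⟨s, mem_wordsUpTo (by simp [l]) hs, (hval s).mpr h⟩

end Words

/-! ### The word problem -/

namespace RAAG

variable {V : Type*} (Γ : SimpleGraph V)

section WordProblem

open Classical in
/-- The action of a letter on a state that is given as a list of coordinates. -/
noncomputable def pushList (a : V × Bool) (E : List ((V × V) × List (V × Bool))) :
    List ((V × V) × List (V × Bool)) :=
  if ∀ p ∈ E, ¬ Acts Γ a.1 p.1 ∨ p.2.head? = some (letterInv a) then
    E.map fun p => (p.1, if Acts Γ a.1 p.1 then p.2.tail else p.2)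
  else E.map fun p => (p.1, if Acts Γ a.1 p.1 then a :: p.2 else p.2)

/-- The list of coordinates of a state. -/
noncomputable def stateList [Fintype V] (σ : State V) : List ((V × V) × List (V × Bool)) :=
  Finset.univ.toList.map fun c => (c, σ c)

/-- Tabulating the finitely many coordinates turns a state into a list, on which `push` can be shown
primitive recursive. -/
theorem pushList_stateList [Fintype V] (a : V × Bool) (σ : State V) :
    pushList Γ a (stateList σ) = stateList (push Γ a σ) := by
  have h : (∀ p ∈ stateList σ, ¬ Acts Γ a.1 p.1 ∨ p.2.head? = some (letterInv a)) ↔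
      Heads Γ (letterInv a) σ := by
    simp [stateList, Heads, ← imp_iff_not_or]
  unfold pushList push
  by_cases hσ : Heads Γ (letterInv a) σ
  · rw [if_pos (h.mpr hσ), if_pos hσ]
    simp [stateList, tailLetter]
  · rw [if_neg (mt h.mp hσ), if_neg hσ]
    simp [stateList, consLetter]

variable [Primcodable V] [Finite V]

theorem primrec_pushList : Primrec₂ (pushList Γ) := by
  classical
  have hacts : PrimrecPred fun q : V × V × V => Acts Γ q.1 q.2 := PrimrecPred.of_finite _
  have hinv : Primrec (letterInv : V × Bool → V × Bool) := Primrec.dom_finite _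
  have hcond : PrimrecRel fun (p : (V × V) × List (V × Bool)) (a : V × Bool) =>
      ¬ Acts Γ a.1 p.1 ∨ p.2.head? = some (letterInv a) := by
    refine PrimrecPred.or (PrimrecPred.not (hacts.comp
      (f := fun q : ((V × V) × List (V × Bool)) × V × Bool => (q.2.1, q.1.1)) ?_)) ?_
    · exact (Primrec.fst.comp Primrec.snd).pair (Primrec.fst.comp Primrec.fst)
    · exact Primrec.eq.comp (Primrec.list_head?.comp (Primrec.snd.comp Primrec.fst))
        (Primrec.option_some.comp (hinv.comp Primrec.snd))
  have hacts' : PrimrecPred fun q : ((V × Bool) × List ((V × V) × List (V × Bool))) ×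
      (V × V) × List (V × Bool) => Acts Γ q.1.1.1 q.2.1 :=
    hacts.comp (f := fun q : ((V × Bool) × List ((V × V) × List (V × Bool))) ×
      (V × V) × List (V × Bool) => (q.1.1.1, q.2.1))
      ((Primrec.fst.comp (Primrec.fst.comp Primrec.fst)).pair (Primrec.fst.comp Primrec.snd))
  have hl : Primrec fun q : ((V × Bool) × List ((V × V) × List (V × Bool))) ×
      (V × V) × List (V × Bool) => q.2.2 := Primrec.snd.comp Primrec.snd
  refine Primrec.ite ?_ (Primrec.list_map Primrec.snd ?_) (Primrec.list_map Primrec.snd ?_)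
  · exact PrimrecPred.comp (p := fun q : List ((V × V) × List (V × Bool)) × V × Bool =>
      ∀ p ∈ q.1, ¬ Acts Γ q.2.1 p.1 ∨ p.2.head? = some (letterInv q.2)) hcond.forall_mem_list
      (Primrec.snd.pair Primrec.fst)
  · exact (Primrec.fst.comp Primrec.snd).pair (Primrec.ite hacts' (Primrec.list_tail.comp hl) hl)
  · exact (Primrec.fst.comp Primrec.snd).pair (Primrec.ite hacts'
      (Primrec.list_cons.comp (Primrec.fst.comp Primrec.fst) hl) hl)

/-- The word problem of a right-angled Artin group is decidable. -/
theorem primrecPred_word_eq_one : PrimrecPred fun w : List (V × Bool) => word Γ w = 1 := by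
  have := Fintype.ofFinite V
  have h1 : Primrec fun w : List (V × Bool) => w.foldr (pushList Γ) (stateList fun _ => []) :=
    Primrec.list_foldr Primrec.id (Primrec.const _) ((primrec_pushList Γ).comp
      (Primrec.fst.comp Primrec.snd) (Primrec.snd.comp Primrec.snd)).to₂
  have h2 : PrimrecPred fun p : (V × V) × List (V × Bool) => p.2 = [] :=
    Primrec.eq.comp Primrec.snd (Primrec.const [])
  refine (h2.forall_mem_list.comp h1).of_eq fun w => ?_
  have h3 : w.foldr (pushList Γ) (stateList fun _ => []) = stateList (state Γ (word Γ w)) := by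
    rw [state_word]
    induction w with
    | nil => rfl
    | cons a w ih => rw [List.foldr_cons, ih, pushList_stateList, List.foldr_cons]
  rw [h3, ← state_eq_nil_iff]
  simp [stateList]

end WordProblem

variable {Γ} {H : Type*} [Group H] (α : H →* MulAut (RAAG Γ))

/-- The word problem of an extension of a right-angled Artin group by a finite group is
decidable. -/
theorem primrecPred_wordValue_eq_one [Primcodable V] [Finite V] [Finite H] {ι : Type*}
    [Primcodable ι] [Finite ι] (x : ι → RAAG Γ ⋊[α] H) :
    PrimrecPred fun w => wordValue x w = 1 := by
  obtain ⟨n, ⟨e⟩⟩ := Finite.exists_equiv_fin H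
  let _ : Primcodable H := Primcodable.ofEquiv (Fin n) e
  let y : ι × Bool → RAAG Γ ⋊[α] H := fun a => if a.2 then x a.1 else (x a.1)⁻¹
  -- A finite table: reading a word from the left, the accumulated `H`-component acts on the left
  -- component of the next letter.
  choose T hT using fun p : H × ι × Bool => exists_word Γ (α p.1 (y p.2).left)
  let step : List (V × Bool) × H → ι × Bool → List (V × Bool) × H :=
    fun s a => (s.1 ++ T (s.2, a), s.2 * (y a).right)
  have hstep : Primrec₂ step := by
    have hT' : Primrec T := Primrec.dom_finite T
    have hr : Primrec fun p : H × ι × Bool => p.1 * (y p.2).right := Primrec.dom_finite _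
    have hp : Primrec fun q : (List (V × Bool) × H) × ι × Bool => (q.1.2, q.2) :=
      (Primrec.snd.comp Primrec.fst).pair Primrec.snd
    exact (Primrec.list_append.comp (Primrec.fst.comp Primrec.fst) (hT'.comp hp)).pair
      (hr.comp hp)
  have hfold : Primrec fun w : List (ι × Bool) => w.foldl step ([], 1) :=
    Primrec.list_foldl Primrec.id (Primrec.const _) (hstep.comp (Primrec.fst.comp Primrec.snd)
      (Primrec.snd.comp Primrec.snd)).to₂
  have hval : ∀ (w : List (ι × Bool)) (s : List (V × Bool) × H),
      (⟨word Γ s.1, s.2⟩ : RAAG Γ ⋊[α] H) * wordValue x w =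
        ⟨word Γ (w.foldl step s).1, (w.foldl step s).2⟩ := by
    intro w
    induction w with
    | nil => intro s; exact mul_one _
    | cons a w ih =>
      intro s
      have h1 : wordValue x (a :: w) = y a * wordValue x w := by simp [wordValue, y]
      rw [List.foldl_cons, ← ih, h1, ← mul_assoc]
      congr 1
      ext <;> simp [step, hT]
  have h1 := ((primrecPred_word_eq_one Γ).comp (Primrec.fst.comp hfold)).and
    (Primrec.eq.comp (Primrec.snd.comp hfold) (Primrec.const 1))
  refine h1.of_eq fun w => ?_
  have h2 := hval w ([], 1)
  have h3 : (⟨word Γ [], 1⟩ : RAAG Γ ⋊[α] H) = 1 := rfl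
  rw [h3, one_mul] at h2
  rw [h2, SemidirectProduct.ext_iff]
  rfl

end RAAG

/-! ### Conjugacy in the extension -/

namespace RAAG

variable {V : Type*} {Γ : SimpleGraph V} [Fintype V] {H : Type*} [Group H]
  {α : H →* MulAut (RAAG Γ)}

/-- Keep the `H`-component of a conjugator and shorten its left component, which solves a twisted
equation for `α Y.right`. -/
theorem exists_short_conjugator (hα : ∀ b g, len Γ (α b g) = len Γ g) {X Y : RAAG Γ ⋊[α] H}
    (h : IsConj X Y) :
    ∃ Z : RAAG Γ ⋊[α] H, Z * X * Z⁻¹ = Y ∧ len Γ Z.left ≤ Fintype.card (V × Bool) *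
      (Fintype.card (V × Bool) + 1) ^
        (Fintype.card (V × Bool) * len Γ Y.left + len Γ X.left) := by
  obtain ⟨Z, hZ⟩ := isConj_iff.mp h
  rw [mul_inv_eq_iff_eq_mul, SemidirectProduct.ext_iff] at hZ
  simp only [SemidirectProduct.mul_left, SemidirectProduct.mul_right] at hZ
  obtain ⟨s, hs, hl⟩ := exists_short_twisted_conjugator (hα Y.right) hZ.1
  rw [hα] at hl
  refine ⟨⟨s, Z.right⟩, ?_, hl⟩
  rw [mul_inv_eq_iff_eq_mul, SemidirectProduct.ext_iff]
  exact ⟨hs, hZ.2⟩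

theorem exists_len_left_wordValue_le (hα : ∀ b g, len Γ (α b g) = len Γ g) {ι : Type*} [Finite ι]
    (x : ι → RAAG Γ ⋊[α] H) : ∃ K, ∀ w, len Γ (wordValue x w).left ≤ K * w.length := by
  obtain ⟨K, hK⟩ := Finite.exists_le fun a : ι × Bool =>
    len Γ (if a.2 then x a.1 else (x a.1)⁻¹).left
  refine ⟨K, fun w => ?_⟩
  induction w with
  | nil => simp [wordValue]
  | cons a w ih =>
    have h1 : wordValue x (a :: w) = (if a.2 then x a.1 else (x a.1)⁻¹) * wordValue x w := by
      simp [wordValue]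
    rw [h1, SemidirectProduct.mul_left, List.length_cons, mul_add, mul_one, add_comm]
    refine (len_mul_le _ _).trans (add_le_add (hK a) ?_)
    rwa [hα]

/-- Spell the left component letter by letter; the `+ 1` pays for the component in the finite group
`H`. -/
theorem exists_wordValue_length_le [Finite H] {ι : Type*} (x : ι → RAAG Γ ⋊[α] H)
    (hx : Subgroup.closure (Set.range x) = ⊤) :
    ∃ K, ∀ Z, ∃ w, wordValue x w = Z ∧ w.length ≤ K * (len Γ Z.left + 1) := by
  choose f hf using exists_wordValue_eq x hx
  obtain ⟨K₁, hK₁⟩ := Finite.exists_le fun a : V × Bool =>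
    (f (SemidirectProduct.inl (letter Γ a))).length
  obtain ⟨K₂, hK₂⟩ := Finite.exists_le fun b : H => (f (SemidirectProduct.inr b)).length
  refine ⟨max K₁ K₂, fun Z => ?_⟩
  obtain ⟨u, hu, hl⟩ := exists_word_length_eq Z.left
  have hw : ∀ u : List (V × Bool), ∃ w, wordValue x w = SemidirectProduct.inl (word Γ u) ∧
      w.length ≤ max K₁ K₂ * u.length := by
    intro u
    induction u with
    | nil => exact ⟨[], by simp [wordValue], by simp⟩
    | cons a u ih =>
      obtain ⟨w, hw, hl⟩ := ih
      refine ⟨f (SemidirectProduct.inl (letter Γ a)) ++ w, ?_, ?_⟩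
      · rw [wordValue_append, hf, hw, word_cons, map_mul]
      · have := (hK₁ a).trans (le_max_left K₁ K₂)
        rw [List.length_append, List.length_cons, mul_add, mul_one]
        omega
  obtain ⟨w, hw, hlw⟩ := hw u
  refine ⟨w ++ f (SemidirectProduct.inr Z.right), ?_, ?_⟩
  · rw [wordValue_append, hf, hw, hu, SemidirectProduct.inl_left_mul_inr_right]
  · have := (hK₂ Z.right).trans (le_max_right K₁ K₂)
    rw [List.length_append, mul_add, mul_one, ← hl]
    omega

/-- The conjugacy problem is solvable in an extension of a right-angled Artin group by a finite
group of length-preserving automorphisms. -/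
theorem conjugacyProblemSolvable [Finite H] (hα : ∀ b g, len Γ (α b g) = len Γ g) :
    ConjugacyProblemSolvable (RAAG Γ ⋊[α] H) := by
  intro k x hx
  let _ : Primcodable V := Primcodable.ofEquiv _ (Fintype.equivFin V)
  obtain ⟨K, hK⟩ := exists_len_left_wordValue_le hα x
  obtain ⟨M, hM⟩ := exists_wordValue_length_le x hx
  set C := Fintype.card (V × Bool)
  have hpow : Primrec₂ fun a b : ℕ => a ^ b := Primrec₂.unpaired'.1 Nat.Primrec.pow
  -- `K` bounds the input lengths in the Artin group, and `M` converts the conjugator back to a word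
  -- in `x`. The exponent dominates the radius `C|g| + |h|`.
  have hB : Primrec fun N => M * (C * (C + 1) ^ ((C + 1) * (K * N)) + 1) :=
    Primrec.nat_mul.comp (Primrec.const M) (Primrec.succ.comp (Primrec.nat_mul.comp
      (Primrec.const C) (hpow.comp (Primrec.const (C + 1)) (Primrec.nat_mul.comp
        (Primrec.const (C + 1)) (Primrec.nat_mul.comp (Primrec.const K) Primrec.id)))))
  refine computablePred_isConj x (primrecPred_wordValue_eq_one α x) hB fun u w huw => ?_
  obtain ⟨Z, hZ, hl⟩ := exists_short_conjugator hα huw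
  obtain ⟨s, rfl, hs⟩ := hM Z
  refine ⟨s, hs.trans (Nat.mul_le_mul_left M (Nat.succ_le_succ (hl.trans ?_))), hZ⟩
  refine Nat.mul_le_mul_left C (Nat.pow_le_pow_right (Nat.succ_pos C) ?_)
  have hu := hK u
  have hw := hK w
  calc C * len Γ (wordValue x w).left + len Γ (wordValue x u).left
      ≤ C * (K * w.length) + K * u.length := add_le_add (Nat.mul_le_mul_left C hw) hu
    _ ≤ (C + 1) * (K * w.length) + (C + 1) * (K * u.length) :=
        add_le_add (Nat.mul_le_mul_right _ (Nat.le_succ C)) (Nat.le_mul_of_pos_left _ C.succ_pos)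
    _ = (C + 1) * (K * (u.length + w.length)) := by ring

end RAAG

theorem cyclicAction_mem_zpowers {N : Type*} [Group N] (m : ℕ) (ψ : MulAut N) (h : ψ ^ m = 1)
    (b : Multiplicative (ZMod m)) : cyclicAction m ψ h b ∈ Subgroup.zpowers ψ := by
  obtain ⟨j, hj⟩ := ZMod.intCast_surjective (Multiplicative.toAdd b)
  have hb : b = Multiplicative.ofAdd (1 : ZMod m) ^ j := by
    rw [← ofAdd_zsmul, zsmul_one, hj, ofAdd_toAdd]
  exact ⟨j, by rw [hb, map_zpow, cyclicAction_gen]⟩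

theorem mainTheorem2 {V : Type*} [Finite V] (Γ : SimpleGraph V) (φ : MulAut (RAAG Γ))
    (hφ : IsLengthPreserving (RAAG.gen Γ) φ) (m : ℕ) (hm : 0 < m) (hφm : φ ^ m = 1) :
    ConjugacyProblemSolvable (CyclicExtension m φ hφm) := by
  have := Fintype.ofFinite V
  -- Positivity of `m` makes the acting group finite, as `ZMod 0` is `ℤ`.
  have : NeZero m := ⟨hm.ne'⟩
  have : Finite (Multiplicative (ZMod m)) := inferInstanceAs (Finite (ZMod m))
  have hlen : ∀ g, RAAG.len Γ (φ g) = RAAG.len Γ g := fun g => by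
    obtain ⟨w, rfl⟩ := RAAG.exists_word Γ g
    rw [← RAAG.wordLength_gen, ← RAAG.wordLength_gen, ← RAAG.wordValue_gen, ← hφ w]
  let S : Subgroup (MulAut (RAAG Γ)) :=
    { carrier := {ψ | ∀ g, RAAG.len Γ (ψ g) = RAAG.len Γ g}
      one_mem' := fun _ => rfl
      mul_mem' := fun {ψ χ} hψ hχ g => (hψ (χ g)).trans (hχ g)
      inv_mem' := fun {ψ} hψ g => by rw [← hψ, MulAut.apply_inv_self] }
  have hS : Subgroup.zpowers φ⁻¹ ≤ S := Subgroup.zpowers_le.mpr (S.inv_mem hlen)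
  exact RAAG.conjugacyProblemSolvable fun b => hS (cyclicAction_mem_zpowers m φ⁻¹ _ b)
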